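/- Let $\Bbbk$ be a noetherian commutative domain. Algebras are associative unital $\Bbbk$-algebras that are projective as $\Bbbk$-modules; "noetherian" means left and right noetherian, and modules are right modules unless said otherwise. For a ring $R$, an exact dimension function on right $R$-modules is an isomorphism-invariant function $\partial:\operatorname{Mod}R\to\mathbb R\cup\{\pm\infty\}$ such that $\partial(M)=\max\{\partial(N),\partial(M/N)\}$ for every finitely generated $M$ and every submodule $N\subseteq M$, and $\partial(M)=\sup\{\partial(N): N\subseteq M \text{ finitely generated}\}$ for every $M$. For noetherian $R$ and $n\ge 0$ let $\operatorname{mod}R$ be the category of finitely generated right $R$-modules, $\operatorname{mod}_nR$ its full subcategory of modules with $\partial(M)\le n$, and $\operatorname{qmod}_nR$ the quotient category $\operatorname{mod}R/\operatorname{mod}_nR$, with projection $\pi:\operatorname{mod}R\to\operatorname{qmod}_nR$. Put $j(M)=\min\{i:\operatorname{Ext}^i_R(M,R)\ne 0\}$, with $j(M)=\infty$ if there is no such $i$. Let $B$ be a noetherian algebra, $e\in B$ an idempotent and $A=eBe$, and assume that $A$ is noetherian, that $eB$ is a finitely generated left $A$-module and that $Be$ is a finitely generated right $A$-module. Let $\partial$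 be an exact dimension function on right $A$-modules and on right $B$-modules such that 1. $\partial(B)=d$ is an integer with $d\ge 2$, and $B$ is $\partial$-CM$(2)$: for every finitely generated right $B$-module $M$, $\partial(M)\le d-2$ if and only if $j(M)\ge 2$; 2. $\partial(N\otimes_BBe)\le\partial(N)$ for every finitely generated right $B$-module $N$ (here $N\otimes_B Be\cong Ne$ as right $A$-modules); 3. for every finitely generated right $A$-module $N$ with $\partial(N)\le d-2$ and for $j=0,1$, the right $B$-module $\operatorname{Tor}^A_j(N,eB)$ is finitely generated with $\partial(\operatorname{Tor}^A_j(N,eB))\le d-2$. Then $-\otimes_BBe:\operatorname{mod}B\to\operatorname{mod}A$ induces a functor $F:\operatorname{qmod}_{d-2}B\to\operatorname{qmod}_{d-2}A$ with $F\pi\cong\pi(-\otimes_BBe)$, and the following are equivalent: (i) $F$ is an equivalence of categories; (ii) the natural map $\varphi:B\to\operatorname{End}_A(Be)$, $\varphi(b)(b'e)=bb'e$, is an isomorphism of algebras; (iii) $\partial(B/BeB)\le d-2$; (iv) $j(B/BeB)\ge 2$. -/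

import Mathlib

open CategoryTheory CategoryTheory.Limits
open scoped TensorProduct

universe u w

noncomputable section

namespace QuotMorita

/-! Right modules over a ring `R` are modules over `Rᵐᵒᵖ`; `MulOpposite.op r • m` is `m r`. -/

section Dimension

variable {R : Type u} [Ring R]

/-- The ring `R` as a right module over itself. -/
abbrev selfRight (R : Type u) [Ring R] : ModuleCat.{u} Rᵐᵒᵖ := ModuleCat.of Rᵐᵒᵖ R

/-- An exact dimension function on right `R`-modules, with values in `ℝ ∪ {±∞}`: it depends only
on the isomorphism class, it is exact on finitely generated modules, and its value on any module is
the supremum of its values on the finitely generated submodules. -/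
structure IsExactDimensionFunction (dim : ModuleCat.{u} Rᵐᵒᵖ → EReal) : Prop where
  iso_invariant : ∀ {M N : ModuleCat.{u} Rᵐᵒᵖ}, (M ≅ N) → dim M = dim N
  exact : ∀ (M : ModuleCat.{u} Rᵐᵒᵖ), Module.Finite Rᵐᵒᵖ M → ∀ N : Submodule Rᵐᵒᵖ M,
    dim M = max (dim (ModuleCat.of Rᵐᵒᵖ N)) (dim (ModuleCat.of Rᵐᵒᵖ (M ⧸ N)))
  eq_iSup_fg : ∀ M : ModuleCat.{u} Rᵐᵒᵖ,
    dim M = ⨆ (N : Submodule Rᵐᵒᵖ M) (_ : N.FG), dim (ModuleCat.of Rᵐᵒᵖ N)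

/-- The grade `j(M) = min {i | Ext^i_R(M, R) ≠ 0}` of a right `R`-module, `∞` if there is no
such `i`. -/
def modGrade (M : ModuleCat.{u} Rᵐᵒᵖ) : ℕ∞ :=
  ⨅ (i : ℕ) (_ : Nontrivial (Abelian.Ext M (selfRight R) i)), (i : ℕ∞)

/-- `R` is `∂`-CM(`s`), where `∂(R) = d`: for all finitely generated right modules `M`,
`∂(M) ≤ d - s` if and only if `j(M) ≥ s`. -/
def IsDimCM (dim : ModuleCat.{u} Rᵐᵒᵖ → EReal) (d s : ℕ) : Prop :=
  dim (selfRight R) = (d : EReal) ∧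
    ∀ M : ModuleCat.{u} Rᵐᵒᵖ, Module.Finite Rᵐᵒᵖ M →
      (dim M ≤ (((d : ℝ) - (s : ℝ) : ℝ) : EReal) ↔ (s : ℕ∞) ≤ modGrade M)

/-- The finitely generated right `R`-modules of `∂`-dimension at most `t`. -/
def modLE (dim : ModuleCat.{u} Rᵐᵒᵖ → EReal) (t : ℝ) :
    ObjectProperty (FGModuleCat.{u} Rᵐᵒᵖ) :=
  fun M => dim M.obj ≤ (t : EReal)

variable [IsNoetherianRing Rᵐᵒᵖ]

/-- The morphisms of `mod R` whose kernel and cokernel have `∂`-dimension at most `t`. -/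
def isoModLE (dim : ModuleCat.{u} Rᵐᵒᵖ → EReal) (t : ℝ) :
    MorphismProperty (FGModuleCat.{u} Rᵐᵒᵖ) :=
  fun _ _ f => modLE dim t (kernel f) ∧ modLE dim t (cokernel f)

/-- The quotient category `qmod_t R = mod R / mod_t R`: the localization of `mod R` that inverts
the morphisms with kernel and cokernel in `mod_t R`. -/
abbrev qmod (dim : ModuleCat.{u} Rᵐᵒᵖ → EReal) (t : ℝ) := (isoModLE dim t).Localization

/-- The projection functor `mod R ⥤ qmod_t R`. -/
abbrev qmodProj (dim : ModuleCat.{u} Rᵐᵒᵖ → EReal) (t : ℝ) :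
    FGModuleCat.{u} Rᵐᵒᵖ ⥤ qmod dim t :=
  (isoModLE dim t).Q

end Dimension

section Tensor

variable (R S : Type u) [Ring R] [Ring S]
  (M : Type u) [AddCommGroup M] [Module Rᵐᵒᵖ M]
  (N : Type u) [AddCommGroup N] [Module R N] [Module Sᵐᵒᵖ N]

/-- The relations `(m r) ⊗ n = m ⊗ (r n)`. The factors are written in the order `n ⊗ m` in the
tensor product over `ℤ`, so that Mathlib supplies the right `S`-module structure
`(n ⊗ m) s = (n s) ⊗ m`. -/
def tensorRel : Submodule Sᵐᵒᵖ (N ⊗[ℤ] M) :=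
  Submodule.span Sᵐᵒᵖ {x | ∃ (m : M) (r : R) (n : N),
    x = n ⊗ₜ[ℤ] (MulOpposite.op r • m) - (r • n) ⊗ₜ[ℤ] m}

/-- The tensor product `M ⊗_R N` of a right `R`-module `M` and an `R`-`S`-bimodule `N`, as a
right `S`-module. -/
abbrev BiTensor : Type u := (N ⊗[ℤ] M) ⧸ tensorRel R S M N

variable {M} in
/-- The element `m ⊗ n` of `M ⊗_R N`. -/
def biTmul (m : M) (n : N) : BiTensor R S M N :=
  (tensorRel R S M N).mkQ (n ⊗ₜ[ℤ] m)

theorem smul_biTmul (m : M) (r : R) (n : N) :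
    biTmul R S N (MulOpposite.op r • m) n = biTmul R S N m (r • n) := by
  refine (Submodule.Quotient.eq _).2 (Submodule.subset_span ⟨m, r, n, rfl⟩)

/-- The map `n ↦ m ⊗ n` of right `S`-modules. -/
def biTmulRight (m : M) : N →ₗ[Sᵐᵒᵖ] BiTensor R S M N where
  toFun n := biTmul R S N m n
  map_add' x y := by simp [biTmul, TensorProduct.add_tmul]
  map_smul' s x := by
    simp only [biTmul, RingHom.id_apply, ← map_smul, TensorProduct.smul_tmul']

theorem biTmul_add (m m' : M) (n : N) :
    biTmul R S N (m + m') n = biTmul R S N m n + biTmul R S N m' n := by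
  simp [biTmul, TensorProduct.tmul_add]

theorem biTmul_sum {ι : Type*} (s : Finset ι) (m : ι → M) (n : N) :
    biTmul R S N (∑ i ∈ s, m i) n = ∑ i ∈ s, biTmul R S N (m i) n := by
  simp [biTmul, TensorProduct.tmul_sum]

variable {M} {M' : Type u} [AddCommGroup M'] [Module Rᵐᵒᵖ M']

/-- The map `f ⊗_R N : M ⊗_R N → M' ⊗_R N`. -/
def biTensorMap (f : M →ₗ[Rᵐᵒᵖ] M') : BiTensor R S M N →ₗ[Sᵐᵒᵖ] BiTensor R S M' N :=
  Submodule.mapQ _ _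
    (TensorProduct.AlgebraTensorModule.map (LinearMap.id : N →ₗ[Sᵐᵒᵖ] N)
      (f.toAddMonoidHom.toIntLinearMap)) (by
    rw [tensorRel, Submodule.span_le]
    rintro _ ⟨m, r, n, rfl⟩
    refine Submodule.subset_span ⟨f m, r, n, ?_⟩
    simp)

@[simp] theorem biTensorMap_tmul (f : M →ₗ[Rᵐᵒᵖ] M') (m : M) (n : N) :
    biTensorMap R S N f (biTmul R S N m n) = biTmul R S N (f m) n := rfl

variable {R S N} in
theorem biTensor_hom_ext {P : Type*} [AddCommGroup P] [Module Sᵐᵒᵖ P]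
    {f g : BiTensor R S M N →ₗ[Sᵐᵒᵖ] P}
    (h : ∀ m n, f (biTmul R S N m n) = g (biTmul R S N m n)) : f = g := by
  refine Submodule.linearMap_qext _ (LinearMap.ext fun x => ?_)
  induction x with
  | zero => simp
  | tmul n m => exact h m n
  | add x y hx hy => rw [map_add, map_add, hx, hy]

/-- The functor `- ⊗_R N` from right `R`-modules to right `S`-modules. -/
def tensorFunctor : ModuleCat.{u} Rᵐᵒᵖ ⥤ ModuleCat.{u} Sᵐᵒᵖ where
  obj M := ModuleCat.of Sᵐᵒᵖ (BiTensor R S M N)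
  map f := ModuleCat.ofHom (biTensorMap R S N f.hom)
  map_id M := by
    ext1
    exact biTensor_hom_ext fun m n => rfl
  map_comp f g := by
    ext1
    exact biTensor_hom_ext fun m n => rfl

instance : (tensorFunctor R S N).Additive where
  map_add {X Y f g} := by
    ext1
    refine biTensor_hom_ext fun m n => ?_
    exact biTmul_add R S Y N (f.hom m) (g.hom m) n

/-- `Tor^R_j(M, N)` as a right `S`-module. -/
def tor (j : ℕ) (M : ModuleCat.{u} Rᵐᵒᵖ) : ModuleCat.{u} Sᵐᵒᵖ :=
  ((tensorFunctor R S N).leftDerived j).obj M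

theorem biTensor_finite [Module.Finite Rᵐᵒᵖ M] [Module.Finite Sᵐᵒᵖ N] :
    Module.Finite Sᵐᵒᵖ (BiTensor R S M N) := by
  obtain ⟨p, g, hg⟩ := Module.Finite.exists_fin (R := Rᵐᵒᵖ) (M := M)
  let F : (Fin p → N) →ₗ[Sᵐᵒᵖ] BiTensor R S M N :=
    ∑ i, (biTmulRight R S M N (g i)).comp (LinearMap.proj i)
  refine Module.Finite.of_surjective F ?_
  rw [← LinearMap.range_eq_top, eq_top_iff]
  rintro x -
  obtain ⟨x, rfl⟩ := (tensorRel R S M N).mkQ_surjective x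
  induction x with
  | zero => simp
  | add x y hx hy => rw [map_add]; exact add_mem hx hy
  | tmul n m =>
    have hm : m ∈ Submodule.span Rᵐᵒᵖ (Set.range g) := hg ▸ Submodule.mem_top
    obtain ⟨c, rfl⟩ := (Submodule.mem_span_range_iff_exists_fun Rᵐᵒᵖ).1 hm
    refine ⟨fun i => (c i).unop • n, ?_⟩
    change F _ = biTmul R S N _ n
    rw [biTmul_sum]
    simp only [F, LinearMap.sum_apply, LinearMap.comp_apply, LinearMap.proj_apply]
    exact Finset.sum_congr rfl fun i _ => (smul_biTmul R S M N (g i) (c i).unop n).symm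

/-- The functor `- ⊗_R N : mod R ⥤ mod S` between categories of finitely generated right modules,
for a bimodule `N` that is finitely generated as a right `S`-module. -/
def fgTensorFunctor [Module.Finite Sᵐᵒᵖ N] :
    FGModuleCat.{u} Rᵐᵒᵖ ⥤ FGModuleCat.{u} Sᵐᵒᵖ :=
  ObjectProperty.lift _ (ObjectProperty.ι _ ⋙ tensorFunctor R S N) fun M =>
    have : Module.Finite Rᵐᵒᵖ M.obj := M.property
    (biTensor_finite R S N : Module.Finite Sᵐᵒᵖ (BiTensor R S M.obj N))

/-- The condition `γ_{t,i}(N)`: for every finitely generated right `R`-module `M` of dimension at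
most `t`, the right `S`-modules `Tor^R_j(M, N)`, `0 ≤ j ≤ i`, are finitely generated of dimension
at most `t`. -/
def SatisfiesGamma (dimR : ModuleCat.{u} Rᵐᵒᵖ → EReal) (dimS : ModuleCat.{u} Sᵐᵒᵖ → EReal)
    (t : ℝ) (i : ℕ) : Prop :=
  ∀ M : ModuleCat.{u} Rᵐᵒᵖ, Module.Finite Rᵐᵒᵖ M → dimR M ≤ (t : EReal) →
    ∀ j ≤ i, Module.Finite Sᵐᵒᵖ (tor R S N j M) ∧ dimS (tor R S N j M) ≤ (t : EReal)

end Tensor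

section Corner

variable {k : Type w} [CommRing k] {B : Type u} [Ring B] [Algebra k B] {e : B}

/-- The left ideal `Be`. -/
abbrev leftIdeal (e : B) : Submodule B B := Submodule.span B {e}

/-- The right ideal `eB`. -/
abbrev rightIdeal (e : B) : Submodule Bᵐᵒᵖ B := Submodule.span Bᵐᵒᵖ {e}

/-- The two-sided ideal `BeB`, as a right ideal. -/
def twoSided (e : B) : Submodule Bᵐᵒᵖ B := Submodule.span Bᵐᵒᵖ {x | ∃ b c : B, x = b * e * c}

/-- The right `B`-module `B / BeB`. -/
abbrev quotBeB (e : B) : ModuleCat.{u} Bᵐᵒᵖ := ModuleCat.of Bᵐᵒᵖ (B ⧸ twoSided e)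

theorem corner_mul_right (he : IsIdempotentElem e) (a : he.Corner) : a.1 * e = a.1 :=
  ((Subsemigroup.mem_corner_iff he).1 a.2).2

theorem corner_mul_left (he : IsIdempotentElem e) (a : he.Corner) : e * a.1 = a.1 :=
  ((Subsemigroup.mem_corner_iff he).1 a.2).1

theorem leftIdeal_mul_e (he : IsIdempotentElem e) {x : B} (hx : x ∈ leftIdeal e) : x * e = x := by
  obtain ⟨b, rfl⟩ := Submodule.mem_span_singleton.1 hx
  simp [mul_assoc, he.eq]

theorem e_mul_rightIdeal (he : IsIdempotentElem e) {x : B} (hx : x ∈ rightIdeal e) : e * x = x := by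
  obtain ⟨b, rfl⟩ := Submodule.mem_span_singleton.1 hx
  simp [← mul_assoc, he.eq]

variable (he : IsIdempotentElem e)

/-- `Be` is a right module over `eBe`, by multiplication in `B`. -/
instance : Module (he.Corner)ᵐᵒᵖ (leftIdeal e) where
  smul a x := ⟨x.1 * a.unop.1, Submodule.mem_span_singleton.2
    ⟨x.1 * a.unop.1, by rw [smul_eq_mul, mul_assoc, corner_mul_right]⟩⟩
  one_smul x := Subtype.ext (leftIdeal_mul_e he x.2)
  mul_smul a b x := Subtype.ext (mul_assoc x.1 b.unop.1 a.unop.1).symm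
  smul_zero a := Subtype.ext (zero_mul _)
  smul_add a x y := Subtype.ext (add_mul _ _ _)
  add_smul a b x := Subtype.ext (mul_add _ _ _)
  zero_smul x := Subtype.ext (mul_zero _)

/-- `eB` is a left module over `eBe`, by multiplication in `B`. -/
instance : Module he.Corner (rightIdeal e) where
  smul a x := ⟨a.1 * x.1, Submodule.mem_span_singleton.2
    ⟨MulOpposite.op (a.1 * x.1), by
      rw [MulOpposite.smul_eq_mul_unop, MulOpposite.unop_op, ← mul_assoc, corner_mul_left]⟩⟩
  one_smul x := Subtype.ext (e_mul_rightIdeal he x.2)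
  mul_smul a b x := Subtype.ext (mul_assoc a.1 b.1 x.1)
  smul_zero a := Subtype.ext (mul_zero _)
  smul_add a x y := Subtype.ext (mul_add _ _ _)
  add_smul a b x := Subtype.ext (add_mul _ _ _)
  zero_smul x := Subtype.ext (zero_mul _)

instance : SMulCommClass B (he.Corner)ᵐᵒᵖ (leftIdeal e) where
  smul_comm b a x := Subtype.ext (mul_assoc b x.1 a.unop.1).symm

instance : SMulCommClass he.Corner Bᵐᵒᵖ (rightIdeal e) where
  smul_comm a b x := Subtype.ext (mul_assoc a.1 x.1 b.unop).symm

/-- `eBe` is a `k`-algebra, with the scalar action inherited from `B`. -/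
instance : Module k he.Corner where
  smul c a := ⟨c • a.1, (Subsemigroup.mem_corner_iff he).2
    ⟨by rw [mul_smul_comm, corner_mul_left], by rw [smul_mul_assoc, corner_mul_right]⟩⟩
  one_smul a := Subtype.ext (one_smul k a.1)
  mul_smul c c' a := Subtype.ext (mul_smul c c' a.1)
  smul_zero c := Subtype.ext (smul_zero c)
  smul_add c a b := Subtype.ext (smul_add c a.1 b.1)
  add_smul c c' a := Subtype.ext (add_smul c c' a.1)
  zero_smul a := Subtype.ext (zero_smul k a.1)

instance : Algebra k he.Corner :=
  Algebra.ofModule (fun c a b => Subtype.ext (smul_mul_assoc c a.1 b.1))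
    (fun c a b => Subtype.ext (mul_smul_comm c a.1 b.1))

instance : IsScalarTower k (he.Corner)ᵐᵒᵖ (leftIdeal e) where
  smul_assoc c a x := Subtype.ext (mul_smul_comm c x.1 a.unop.1)

instance : SMulCommClass (he.Corner)ᵐᵒᵖ k (leftIdeal e) where
  smul_comm a c x := Subtype.ext (Algebra.smul_mul_assoc c x.1 a.unop.1)

instance : SMulCommClass k (he.Corner)ᵐᵒᵖ (leftIdeal e) := SMulCommClass.symm _ _ _

variable (k) in
/-- The natural algebra map `φ : B → End_A(Be)`, `φ(b)(b'e) = bb'e`, where `A = eBe`. -/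
def leftMulHom : B →ₐ[k] Module.End (he.Corner)ᵐᵒᵖ (leftIdeal e) :=
  Algebra.lsmul k (he.Corner)ᵐᵒᵖ (leftIdeal e)

theorem leftMulHom_apply (b : B) (x : leftIdeal e) :
    ((leftMulHom k he b x : leftIdeal e) : B) = b * (x : B) := rfl

end Corner

end QuotMorita

end

open QuotMorita

/-! Call a module small if its dimension is at most `t = d - 2`. Restriction `N ↦ N ⊗_B Be ≅ Ne` is
exact, and its left adjoint `- ⊗_A eB` has invertible unit: `(M ⊗_A eB)e ≅ M`. By a triangle
identity the counit `Ne ⊗_A eB → N` becomes invertible after restriction. So everything depends on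
whether `Ne` small forces `N` small.

(iii) ⇒ (i): if `Ne` is small, the image of the counit is a quotient of `Tor_0(Ne, eB)`, small by
condition 3. Its cokernel is killed by `e`, hence is a module over `B/BeB`, and its cyclic
submodules are quotients of `B/BeB`. So `N` is small (`dim_le_of_restrict_le`). By exactness, a
morphism is then inverted by the projection from `mod B` exactly when its restriction is inverted by
the one from `mod A`, and the two functors descend to inverse equivalences
(`isEquivalence_of_lifting`).

(i) ⇒ (iii): `(B/BeB)e = 0`, so `F` kills the image of `B/BeB`. An equivalence reflects zero
objects, and the projection to `qmod` kills only small modules.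

(iii) ⇔ (iv) is the Cohen-Macaulay condition for `B/BeB`. For (iv) ⇔ (ii), the long exact sequence
of `0 → BeB → B → B/BeB → 0` shows that `j(B/BeB) ≥ 2` means that left multiplication `B →
Hom_B(BeB, B)` is bijective. Once it is injective, restriction to `Be` identifies `Hom_B(BeB, B)`
with `End_A(Be)`; the inverse extends `θ` by `xc ↦ θ(x)c` (`exists_extend_twoSided`). -/

noncomputable section

namespace QuotMorita

/-! ### Dimension functions and the Serre class of small modules -/

section DimensionFunction

variable {R : Type u} [Ring R] {dim : ModuleCat.{u} Rᵐᵒᵖ → EReal}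

theorem IsExactDimensionFunction.eq_of_linearEquiv (h : IsExactDimensionFunction dim)
    {M N : Type u} [AddCommGroup M] [Module Rᵐᵒᵖ M] [AddCommGroup N] [Module Rᵐᵒᵖ N]
    (f : M ≃ₗ[Rᵐᵒᵖ] N) : dim (ModuleCat.of _ M) = dim (ModuleCat.of _ N) :=
  h.iso_invariant f.toModuleIso

theorem IsExactDimensionFunction.exact' (h : IsExactDimensionFunction dim)
    {M : Type u} [AddCommGroup M] [Module Rᵐᵒᵖ M] [Module.Finite Rᵐᵒᵖ M] (N : Submodule Rᵐᵒᵖ M) :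
    dim (ModuleCat.of _ M) = max (dim (ModuleCat.of _ N)) (dim (ModuleCat.of _ (M ⧸ N))) :=
  h.exact (ModuleCat.of _ M) ‹_› N

theorem IsExactDimensionFunction.le_of_injective (h : IsExactDimensionFunction dim)
    {M N : Type u} [AddCommGroup M] [Module Rᵐᵒᵖ M] [AddCommGroup N] [Module Rᵐᵒᵖ N]
    [Module.Finite Rᵐᵒᵖ N] (f : M →ₗ[Rᵐᵒᵖ] N) (hf : Function.Injective f) :
    dim (ModuleCat.of _ M) ≤ dim (ModuleCat.of _ N) := by
  rw [h.eq_of_linearEquiv (LinearEquiv.ofInjective f hf), h.exact' (LinearMap.range f)]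
  exact le_max_left _ _

theorem IsExactDimensionFunction.le_of_surjective (h : IsExactDimensionFunction dim)
    {M N : Type u} [AddCommGroup M] [Module Rᵐᵒᵖ M] [AddCommGroup N] [Module Rᵐᵒᵖ N]
    [Module.Finite Rᵐᵒᵖ M] (f : M →ₗ[Rᵐᵒᵖ] N) (hf : Function.Surjective f) :
    dim (ModuleCat.of _ N) ≤ dim (ModuleCat.of _ M) := by
  rw [h.exact' (LinearMap.ker f), h.eq_of_linearEquiv (f.quotKerEquivOfSurjective hf)]
  exact le_max_right _ _

theorem IsExactDimensionFunction.le_of_submodule (h : IsExactDimensionFunction dim)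
    {M : Type u} [AddCommGroup M] [Module Rᵐᵒᵖ M] [Module.Finite Rᵐᵒᵖ M] {t : EReal}
    (N : Submodule Rᵐᵒᵖ M) (h₁ : dim (ModuleCat.of _ N) ≤ t)
    (h₂ : dim (ModuleCat.of _ (M ⧸ N)) ≤ t) : dim (ModuleCat.of _ M) ≤ t := by
  rw [h.exact' N]
  exact max_le h₁ h₂

theorem fg_finite (X : FGModuleCat.{u} Rᵐᵒᵖ) : Module.Finite Rᵐᵒᵖ X.obj := X.property

attribute [local instance] fg_finite

variable [IsNoetherianRing Rᵐᵒᵖ]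

/-- A finitely generated module is small if all its cyclic submodules are. -/
theorem IsExactDimensionFunction.le_of_cyclic (h : IsExactDimensionFunction dim)
    {M : Type u} [AddCommGroup M] [Module Rᵐᵒᵖ M] [Module.Finite Rᵐᵒᵖ M] {t : EReal}
    (hM : ∀ x : M, dim (ModuleCat.of _ (Submodule.span Rᵐᵒᵖ {x})) ≤ t) :
    dim (ModuleCat.of _ M) ≤ t := by
  have key : ∀ N : Submodule Rᵐᵒᵖ M, N.FG → dim (ModuleCat.of _ N) ≤ t := by
    intro N hN
    induction N, hN using Submodule.fg_induction with
    | singleton x => exact hM x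
    | sup N₁ N₂ _ _ h₁ h₂ =>
      -- `(N₁ + N₂)/N₁` is a quotient of `N₂` by the second isomorphism theorem.
      refine h.le_of_submodule ((N₁.comap (N₁ ⊔ N₂).subtype)) ?_ ?_
      · rwa [h.eq_of_linearEquiv (Submodule.comapSubtypeEquivOfLe le_sup_left)]
      · rw [← h.eq_of_linearEquiv ((LinearMap.quotientInfEquivSupQuotient N₂ N₁).trans
          (Submodule.Quotient.equiv _ _ (LinearEquiv.ofEq _ _ (sup_comm N₂ N₁)) ?_))]
        · exact (h.le_of_surjective (Submodule.mkQ _) (Submodule.mkQ_surjective _)).trans h₂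
        · ext x
          simp
  rw [← h.eq_of_linearEquiv (Submodule.topEquiv (R := Rᵐᵒᵖ) (M := M))]
  exact key ⊤ (IsNoetherian.noetherian _)

theorem fg_mono_iff {X Y : FGModuleCat.{u} Rᵐᵒᵖ} (f : X ⟶ Y) :
    Mono f ↔ Function.Injective f.hom.hom := by
  rw [← ModuleCat.mono_iff_injective]
  exact ⟨fun _ => inferInstanceAs (Mono ((forget₂ _ (ModuleCat Rᵐᵒᵖ)).map f)),
    fun h => (forget₂ _ (ModuleCat Rᵐᵒᵖ)).mono_of_mono_map h⟩

theorem fg_epi_iff {X Y : FGModuleCat.{u} Rᵐᵒᵖ} (f : X ⟶ Y) :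
    Epi f ↔ Function.Surjective f.hom.hom := by
  rw [← ModuleCat.epi_iff_surjective]
  exact ⟨fun _ => inferInstanceAs (Epi ((forget₂ _ (ModuleCat Rᵐᵒᵖ)).map f)),
    fun h => (forget₂ _ (ModuleCat Rᵐᵒᵖ)).epi_of_epi_map h⟩

theorem isoModLE_iff (h : IsExactDimensionFunction dim) {t : ℝ}
    {X Y : FGModuleCat.{u} Rᵐᵒᵖ} (f : X ⟶ Y) :
    isoModLE dim t f ↔ dim (ModuleCat.of _ (LinearMap.ker f.hom.hom)) ≤ t ∧
      dim (ModuleCat.of _ (Y.obj ⧸ LinearMap.range f.hom.hom)) ≤ t := by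
  have e₁ : (forget₂ _ (ModuleCat Rᵐᵒᵖ)).obj (kernel f) ≅
      ModuleCat.of _ (LinearMap.ker f.hom.hom) :=
    PreservesKernel.iso (forget₂ (FGModuleCat.{u} Rᵐᵒᵖ) (ModuleCat.{u} Rᵐᵒᵖ)) f ≪≫
      ModuleCat.kernelIsoKer _
  have e₂ : (forget₂ _ (ModuleCat Rᵐᵒᵖ)).obj (cokernel f) ≅
      ModuleCat.of _ (Y.obj ⧸ LinearMap.range f.hom.hom) :=
    PreservesCokernel.iso (forget₂ (FGModuleCat.{u} Rᵐᵒᵖ) (ModuleCat.{u} Rᵐᵒᵖ)) f ≪≫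
      ModuleCat.cokernelIsoRangeQuotient _
  rw [← h.iso_invariant e₁, ← h.iso_invariant e₂]
  rfl

/-- The bound `h0` is a genuine hypothesis: every constant function is an exact dimension function,
so the axioms do not bound the dimension of the zero module. -/
theorem isSerreClass_modLE (h : IsExactDimensionFunction dim) {t : ℝ}
    (h0 : dim (ModuleCat.of _ PUnit) ≤ t) : (modLE dim t).IsSerreClass where
  exists_zero := by
    refine ⟨FGModuleCat.of Rᵐᵒᵖ PUnit, ?_, h0⟩
    rw [IsZero.iff_id_eq_zero]
    ext
  prop_of_mono f hf hY :=
    (h.le_of_injective f.hom.hom ((fg_mono_iff f).1 hf)).trans hY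
  prop_of_epi f hf hX :=
    (h.le_of_surjective f.hom.hom ((fg_epi_iff f).1 hf)).trans hX
  prop_X₂_of_shortExact {S} hS h₁ h₃ := by
    have := hS.map_of_exact (forget₂ (FGModuleCat.{u} Rᵐᵒᵖ) (ModuleCat.{u} Rᵐᵒᵖ))
    have inj := (fg_mono_iff _).1 hS.mono_f
    have surj := (fg_epi_iff _).1 hS.epi_g
    have ex : LinearMap.range S.f.hom.hom = LinearMap.ker S.g.hom.hom :=
      this.exact.moduleCat_range_eq_ker
    refine h.le_of_submodule (M := S.X₂.obj) (LinearMap.range S.f.hom.hom) ?_ ?_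
    · rw [← h.eq_of_linearEquiv (LinearEquiv.ofInjective _ inj)]
      exact h₁
    · rw [ex, h.eq_of_linearEquiv (S.g.hom.hom.quotKerEquivOfSurjective surj)]
      exact h₃

/-- `W` is a variable so that the statement applies to `isoModLE`, which is `isoModSerre` only after
unfolding. -/
theorem isZero_Q_obj_iff {C : Type*} [Category C] [Abelian C] (P : ObjectProperty C)
    [P.IsSerreClass] {W : MorphismProperty C} (hW : W = P.isoModSerre) (X : C) :
    IsZero (W.Q.obj X) ↔ P X := by
  subst hW
  exact ObjectProperty.SerreClassLocalization.isZero_obj_iff _ P X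

theorem isZero_qmodProj_obj_iff (h : IsExactDimensionFunction dim) {t : ℝ}
    (h0 : dim (ModuleCat.of _ PUnit) ≤ t) (X : FGModuleCat.{u} Rᵐᵒᵖ) :
    IsZero ((qmodProj dim t).obj X) ↔ dim X.obj ≤ t :=
  have := isSerreClass_modLE h h0
  isZero_Q_obj_iff (modLE dim t) rfl X

end DimensionFunction

/-! ### Maps out of the balanced tensor product -/

section TensorLift

variable (R S : Type u) [Ring R] [Ring S]
  {M : Type u} [AddCommGroup M] [Module Rᵐᵒᵖ M]
  (N : Type u) [AddCommGroup N] [Module R N] [Module Sᵐᵒᵖ N]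

theorem smul_right_biTmul (m : M) (n : N) (s : Sᵐᵒᵖ) :
    s • biTmul R S N m n = biTmul R S N m (s • n) :=
  ((biTmulRight R S M N m).map_smul s n).symm

theorem zero_biTmul (n : N) : biTmul R S N (0 : M) n = 0 := by
  simp [biTmul]

variable {R S N} in
@[elab_as_elim]
theorem biTensor_induction {p : BiTensor R S M N → Prop} (t : BiTensor R S M N)
    (zero : p 0) (tmul : ∀ m n, p (biTmul R S N m n)) (add : ∀ x y, p x → p y → p (x + y)) :
    p t := by
  obtain ⟨t, rfl⟩ := (tensorRel R S M N).mkQ_surjective t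
  induction t with
  | zero => simpa using zero
  | add x y hx hy => rw [map_add]; exact add _ _ hx hy
  | tmul n m => exact tmul m n

variable {R S N} [SMulCommClass R Sᵐᵒᵖ N] {P : Type u} [AddCommGroup P]

/-- The additive map out of `M ⊗_R N` induced by a balanced biadditive map. -/
def biTensorLift (f : N →+ M →+ P)
    (hf : ∀ m (r : R) n, f n (MulOpposite.op r • m) = f (r • n) m) : BiTensor R S M N →+ P :=
  QuotientAddGroup.lift (tensorRel R S M N).toAddSubgroup
    (TensorProduct.liftAddHom f (fun z n m => by simp)) (by
      -- The relations are spanned over `Sᵐᵒᵖ` but the lifted map is only additive, so the induction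
      -- must carry all multiples `s • x`.
      suffices ∀ x ∈ tensorRel R S M N, ∀ s : Sᵐᵒᵖ,
          TensorProduct.liftAddHom f (fun (z : ℤ) n m => by simp) (s • x) = 0 from
        fun x hx => by simpa using this x hx 1
      intro x hx
      induction hx using Submodule.span_induction with
      | zero => simp
      | add x y _ _ hx hy => intro s; rw [smul_add, map_add, hx, hy, add_zero]
      | smul a x _ hx => intro s; rw [smul_smul]; exact hx _
      | mem x hx =>
        obtain ⟨m, r, n, rfl⟩ := hx
        intro s
        simp [smul_sub, TensorProduct.smul_tmul', hf, smul_comm r s n])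

@[simp] theorem biTensorLift_tmul (f : N →+ M →+ P)
    (hf : ∀ m (r : R) n, f n (MulOpposite.op r • m) = f (r • n) m) (m : M) (n : N) :
    biTensorLift (S := S) f hf (biTmul R S N m n) = f n m := rfl

end TensorLift

/-! ### The surjection from `Tor_0` onto the tensor product -/

section TorZero

/-- Preservation of epimorphisms suffices, without right exactness: for a projective resolution `P`
of `X`, the epimorphism `F(P₀) → F(X)` factors through `L₀F(X) → F(X)`. -/
theorem epi_fromLeftDerivedZero_app {C D : Type*} [Category C] [Category D] [Abelian C]
    [HasProjectiveResolutions C] [Abelian D] (F : C ⥤ D) [F.Additive] [F.PreservesEpimorphisms]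
    (X : C) : Epi (F.fromLeftDerivedZero.app X) := by
  rw [(projectiveResolution X).fromLeftDerivedZero_eq]
  have h₀ : Epi ((projectiveResolution X).π.f 0) := inferInstance
  have h₁ := F.map_epi ((projectiveResolution X).π.f 0)
  rw [← ProjectiveResolution.pOpcycles_comp_fromLeftDerivedZero'] at h₁
  have h₂ := @epi_of_epi _ _ _ _ _ _ _ h₁
  exact @epi_comp _ _ _ _ _ _ (@IsIso.epi_of_iso _ _ _ _ _ (Iso.isIso_hom _)) _
    (@epi_comp _ _ _ _ _ _ (@IsIso.epi_of_iso _ _ _ _ _ (Iso.isIso_hom _)) _ h₂)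

variable (R S : Type u) [Ring R] [Ring S]
  (N : Type u) [AddCommGroup N] [Module R N] [Module Sᵐᵒᵖ N]

theorem biTensorMap_surjective {M M' : Type u} [AddCommGroup M] [Module Rᵐᵒᵖ M]
    [AddCommGroup M'] [Module Rᵐᵒᵖ M'] (f : M →ₗ[Rᵐᵒᵖ] M') (hf : Function.Surjective f) :
    Function.Surjective (biTensorMap R S N f) := by
  intro t
  induction t using biTensor_induction with
  | zero => exact ⟨0, map_zero _⟩
  | tmul m n =>
    obtain ⟨m, rfl⟩ := hf m
    exact ⟨biTmul R S N m n, rfl⟩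
  | add x y hx hy =>
    obtain ⟨x, rfl⟩ := hx
    obtain ⟨y, rfl⟩ := hy
    exact ⟨x + y, map_add _ _ _⟩

instance : (tensorFunctor R S N).PreservesEpimorphisms where
  preserves f hf := by
    rw [ModuleCat.epi_iff_surjective] at hf ⊢
    exact biTensorMap_surjective R S N f.hom hf

theorem exists_epi_tor_zero (M : ModuleCat.{u} Rᵐᵒᵖ) :
    ∃ f : tor R S N 0 M ⟶ (tensorFunctor R S N).obj M, Epi f := by
  exact ⟨(tensorFunctor R S N).fromLeftDerivedZero.app M, epi_fromLeftDerivedZero_app _ M⟩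

end TorZero

/-! ### Restriction to the corner: exactness of `N ↦ Ne` -/

section Corner

variable {B : Type u} [Ring B] {e : B}

/-- `e` as an element of `Be`. -/
abbrev leftE (e : B) : leftIdeal e := ⟨e, Submodule.mem_span_singleton_self e⟩

/-- `e` as an element of `eB`. -/
abbrev rightE (e : B) : rightIdeal e := ⟨e, Submodule.mem_span_singleton_self e⟩

theorem smul_leftE (he : IsIdempotentElem e) (y : leftIdeal e) : y.1 • leftE e = y :=
  Subtype.ext (leftIdeal_mul_e he y.2)

variable (he : IsIdempotentElem e)

/-- The product of an element of `eB` and an element of `Be`, as an element of `eBe`. -/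
def cornerMul (x : rightIdeal e) (y : leftIdeal e) : he.Corner :=
  ⟨x.1 * y.1, (Subsemigroup.mem_corner_iff he).2
    ⟨by rw [← mul_assoc, e_mul_rightIdeal he x.2], by rw [mul_assoc, leftIdeal_mul_e he y.2]⟩⟩

theorem coe_smul_leftIdeal (a : (he.Corner)ᵐᵒᵖ) (x : leftIdeal e) :
    ((a • x : leftIdeal e) : B) = x.1 * a.unop.1 := rfl

theorem coe_smul_rightIdeal (a : he.Corner) (x : rightIdeal e) :
    ((a • x : rightIdeal e) : B) = a.1 * x.1 := rfl

theorem cornerMul_smul_rightE (x : rightIdeal e) :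
    cornerMul he x (leftE e) • rightE e = MulOpposite.op e • x :=
  Subtype.ext (show x.1 * e * e = x.1 * e by rw [mul_assoc, he.eq])

variable (N : Type u) [AddCommGroup N] [Module Bᵐᵒᵖ N]

/-- The map `N ⊗_B Be → N`, `n ⊗ x ↦ n x`; it identifies `N ⊗_B Be` with `N e`. -/
def restrictEval : BiTensor B he.Corner N (leftIdeal e) →+ N :=
  biTensorLift (AddMonoidHom.mk' (fun x => DistribSMul.toAddMonoidHom N (MulOpposite.op x.1))
      fun x y => by ext n; simp [add_smul])
    fun n b x => by simp [smul_smul]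

variable {N}

@[simp] theorem restrictEval_tmul (n : N) (x : leftIdeal e) :
    restrictEval he N (biTmul B he.Corner (leftIdeal e) n x) = MulOpposite.op x.1 • n := rfl

/-- Since `x = xe` in `Be`, `n ⊗ x = nx ⊗ e`. Thus every tensor is recovered from its value in `N`,
and identities in `N ⊗_B Be` can be checked inside `N`. -/
theorem restrictEval_biTmul_e (t : BiTensor B he.Corner N (leftIdeal e)) :
    biTmul B he.Corner (leftIdeal e) (restrictEval he N t) (leftE e) = t := by
  induction t using biTensor_induction with
  | zero => rw [map_zero, zero_biTmul]
  | tmul n x => rw [restrictEval_tmul, smul_biTmul, smul_leftE he]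
  | add x y hx hy => rw [map_add, biTmul_add, hx, hy]

theorem restrictEval_injective : Function.Injective (restrictEval he N) := fun t t' h => by
  rw [← restrictEval_biTmul_e he t, h, restrictEval_biTmul_e]

theorem op_e_smul_restrictEval (t : BiTensor B he.Corner N (leftIdeal e)) :
    MulOpposite.op e • restrictEval he N t = restrictEval he N t := by
  conv_rhs => rw [← restrictEval_biTmul_e he t]
  rfl

theorem restrictEval_smul (a : (he.Corner)ᵐᵒᵖ) (t : BiTensor B he.Corner N (leftIdeal e)) :
    restrictEval he N (a • t) = MulOpposite.op a.unop.1 • restrictEval he N t := by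
  induction t using biTensor_induction with
  | zero => simp
  | tmul n x =>
    rw [smul_right_biTmul, restrictEval_tmul, restrictEval_tmul, smul_smul]
    rfl
  | add x y hx hy => simp only [smul_add, map_add, hx, hy]

variable {N' : Type u} [AddCommGroup N'] [Module Bᵐᵒᵖ N'] (f : N →ₗ[Bᵐᵒᵖ] N')

theorem restrictEval_map (t : BiTensor B he.Corner N (leftIdeal e)) :
    restrictEval he N' (biTensorMap B he.Corner (leftIdeal e) f t) = f (restrictEval he N t) := by
  induction t using biTensor_induction with
  | zero => simp
  | tmul n x => simp
  | add x y hx hy => simp only [map_add, hx, hy]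

/-- Under the evaluation `N ⊗_B Be → N`, the induced map is a restriction of `f`. -/
theorem biTensorMap_leftIdeal_injective (hf : Function.Injective f) :
    Function.Injective (biTensorMap B he.Corner (leftIdeal e) f) := fun t t' h => by
  apply restrictEval_injective he
  apply hf
  rw [← restrictEval_map, h, restrictEval_map]

theorem ker_biTensorMap_leftIdeal :
    LinearMap.ker (biTensorMap B he.Corner (leftIdeal e) f) =
      LinearMap.range (biTensorMap B he.Corner (leftIdeal e) (LinearMap.ker f).subtype) := by
  refine le_antisymm (fun t ht => ?_) ?_
  · have h : f (restrictEval he N t) = 0 := by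
      rw [← restrictEval_map, LinearMap.mem_ker.1 ht, map_zero]
    exact ⟨biTmul B he.Corner (leftIdeal e) (⟨_, h⟩ : LinearMap.ker f) (leftE e),
      restrictEval_biTmul_e he t⟩
  · rintro _ ⟨t, rfl⟩
    apply restrictEval_injective he
    rw [restrictEval_map, restrictEval_map, map_zero]
    exact (restrictEval he (LinearMap.ker f) t).2

theorem ker_biTensorMap_leftIdeal_mkQ :
    LinearMap.ker (biTensorMap B he.Corner (leftIdeal e) (LinearMap.range f).mkQ) =
      LinearMap.range (biTensorMap B he.Corner (leftIdeal e) f) := by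
  refine le_antisymm (fun t ht => ?_) ?_
  · have h : (LinearMap.range f).mkQ (restrictEval he N' t) = 0 := by
      rw [← restrictEval_map, LinearMap.mem_ker.1 ht, map_zero]
    obtain ⟨x, hx⟩ := (Submodule.Quotient.mk_eq_zero _).1 h
    refine ⟨biTmul B he.Corner (leftIdeal e) x (leftE e), ?_⟩
    rw [biTensorMap_tmul, hx, restrictEval_biTmul_e]
  · rintro _ ⟨t, rfl⟩
    apply restrictEval_injective he
    rw [restrictEval_map, restrictEval_map, map_zero]
    simp

/-- Restriction to `e` commutes with kernels. -/
def kerRestrictEquiv : BiTensor B he.Corner (LinearMap.ker f) (leftIdeal e) ≃ₗ[(he.Corner)ᵐᵒᵖ]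
    LinearMap.ker (biTensorMap B he.Corner (leftIdeal e) f) :=
  (LinearEquiv.ofInjective _ (biTensorMap_leftIdeal_injective he (LinearMap.ker f).subtype
    Subtype.val_injective)).trans (LinearEquiv.ofEq _ _ (ker_biTensorMap_leftIdeal he f).symm)

/-- Restriction to `e` commutes with cokernels. -/
def cokerRestrictEquiv :
    (BiTensor B he.Corner N' (leftIdeal e) ⧸
      LinearMap.range (biTensorMap B he.Corner (leftIdeal e) f)) ≃ₗ[(he.Corner)ᵐᵒᵖ]
    BiTensor B he.Corner (N' ⧸ LinearMap.range f) (leftIdeal e) :=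
  (Submodule.quotEquivOfEq _ _ (ker_biTensorMap_leftIdeal_mkQ he f).symm).trans
    (LinearMap.quotKerEquivOfSurjective _
      (biTensorMap_surjective B he.Corner _ _ (Submodule.mkQ_surjective _)))

end Corner

/-! ### Unit and counit of induction and restriction -/

section Adjunction

variable {B : Type u} [Ring B] {e : B} (he : IsIdempotentElem e)

section

variable (M : Type u) [AddCommGroup M] [Module (he.Corner)ᵐᵒᵖ M]

/-- The map `M ⊗_A eB → M`, `m ⊗ x ↦ m (x e)`. -/
def inductEval : BiTensor he.Corner B M (rightIdeal e) →+ M :=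
  biTensorLift (AddMonoidHom.mk' (fun x =>
      DistribSMul.toAddMonoidHom M (MulOpposite.op (cornerMul he x (leftE e))))
      fun x y => by
        ext m
        simp only [DistribSMul.toAddMonoidHom_apply, AddMonoidHom.add_apply, ← add_smul,
          ← MulOpposite.op_add]
        congr 2
        exact Subtype.ext (add_mul _ _ _))
    fun m a x => by
      simp only [AddMonoidHom.mk'_apply, DistribSMul.toAddMonoidHom_apply, smul_smul,
        ← MulOpposite.op_mul]
      congr 2
      exact Subtype.ext (mul_assoc _ _ _).symm

variable {M}

theorem inductEval_tmul_e (m : M) :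
    inductEval he M (biTmul he.Corner B (rightIdeal e) m (rightE e)) = m := by
  have : cornerMul he (rightE e) (leftE e) = 1 := Subtype.ext he.eq
  change MulOpposite.op (cornerMul he (rightE e) (leftE e)) • m = m
  rw [this, MulOpposite.op_one, one_smul]

/-- For `x` in `eB` the element `xe` lies in `A`, so it moves across the tensor sign: `m(xe) ⊗ e = m
⊗ xe = (m ⊗ x)e`. -/
theorem biTmul_inductEval (t : BiTensor he.Corner B M (rightIdeal e)) :
    biTmul he.Corner B (rightIdeal e) (inductEval he M t) (rightE e) = MulOpposite.op e • t := by
  induction t using biTensor_induction with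
  | zero => rw [map_zero, zero_biTmul, smul_zero]
  | tmul m x =>
    rw [smul_right_biTmul, ← cornerMul_smul_rightE he, ← smul_biTmul]
    rfl
  | add x y hx hy => rw [map_add, biTmul_add, hx, hy, smul_add]

variable (M)

/-- The unit `M → (M ⊗_A eB) ⊗_B Be`. -/
def inductUnit : M →ₗ[(he.Corner)ᵐᵒᵖ]
    BiTensor B he.Corner (BiTensor he.Corner B M (rightIdeal e)) (leftIdeal e) where
  toFun m := biTmul B he.Corner (leftIdeal e)
    (biTmul he.Corner B (rightIdeal e) m (rightE e)) (leftE e)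
  map_add' m m' := by rw [biTmul_add, biTmul_add]
  map_smul' a m := by
    -- After evaluation both sides are `m ⊗ a`, because `ea = a = ae`.
    apply restrictEval_injective he
    rw [RingHom.id_apply, restrictEval_smul, restrictEval_tmul, restrictEval_tmul,
      smul_right_biTmul, smul_right_biTmul, smul_right_biTmul, ← MulOpposite.op_unop a, smul_biTmul]
    congr 1
    ext
    simp only [coe_smul_rightIdeal, Submodule.coe_smul_of_tower, MulOpposite.smul_eq_mul_unop,
      MulOpposite.unop_op, he.eq, corner_mul_left, corner_mul_right]

/-- The inverse is the composite of the two evaluations. -/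
theorem inductUnit_bijective : Function.Bijective (inductUnit he M) := by
  constructor
  · intro m m' h
    have h := congrArg (fun t => inductEval he M (restrictEval he _ t)) h
    simpa only [inductUnit, LinearMap.coe_mk, AddHom.coe_mk, restrictEval_tmul,
      ← biTmul_inductEval, inductEval_tmul_e] using h
  · intro t
    refine ⟨inductEval he M (restrictEval he _ t), restrictEval_injective he ?_⟩
    simp only [inductUnit, LinearMap.coe_mk, AddHom.coe_mk, restrictEval_tmul,
      biTmul_inductEval, op_e_smul_restrictEval]

end

section

variable (N : Type u) [AddCommGroup N] [Module Bᵐᵒᵖ N]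

/-- The counit `(N ⊗_B Be) ⊗_A eB → N`. -/
def inductCounit : BiTensor he.Corner B (BiTensor B he.Corner N (leftIdeal e)) (rightIdeal e)
    →ₗ[Bᵐᵒᵖ] N where
  __ := biTensorLift (AddMonoidHom.mk' (fun x =>
      (DistribSMul.toAddMonoidHom N (MulOpposite.op x.1)).comp (restrictEval he N))
      fun x y => by ext n; simp [add_smul])
    fun t a x => by
      simp only [AddMonoidHom.mk'_apply, AddMonoidHom.comp_apply, restrictEval_smul,
        DistribSMul.toAddMonoidHom_apply, smul_smul, ← MulOpposite.op_mul]
      rfl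
  map_smul' b t := by
    change biTensorLift _ _ _ = b • biTensorLift _ _ _
    induction t using biTensor_induction with
    | zero => simp
    | tmul t x =>
      rw [smul_right_biTmul, biTensorLift_tmul, biTensorLift_tmul]
      simp [smul_smul]
    | add x y hx hy => simp only [smul_add, map_add, hx, hy]

variable {N}

@[simp] theorem inductCounit_tmul (t : BiTensor B he.Corner N (leftIdeal e)) (x : rightIdeal e) :
    inductCounit he N (biTmul he.Corner B (rightIdeal e) t x) =
      MulOpposite.op x.1 • restrictEval he N t := rfl

theorem biTensorMap_inductCounit_comp_inductUnit (t : BiTensor B he.Corner N (leftIdeal e)) :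
    biTensorMap B he.Corner (leftIdeal e) (inductCounit he N) (inductUnit he _ t) = t := by
  change biTmul B he.Corner (leftIdeal e) (MulOpposite.op e • restrictEval he N t) (leftE e) = t
  rw [op_e_smul_restrictEval, restrictEval_biTmul_e]

/-- This makes the cokernel of the counit a module killed by `e`. -/
theorem op_e_smul_mem_range_inductCounit (n : N) :
    MulOpposite.op e • n ∈ LinearMap.range (inductCounit he N) := by
  refine ⟨biTmul he.Corner B (rightIdeal e) (biTmul B he.Corner (leftIdeal e) n (leftE e))
    (rightE e), ?_⟩
  rw [inductCounit_tmul, restrictEval_tmul, smul_smul, ← MulOpposite.op_mul, he.eq]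

end

end Adjunction

/-! ### Grade at least two for cyclic modules -/

section Grade

open Abelian

variable {R : Type u} [Ring R]

theorem two_le_modGrade_iff (M : ModuleCat.{u} Rᵐᵒᵖ) : 2 ≤ modGrade M ↔
    Subsingleton (Ext M (selfRight R) 0) ∧ Subsingleton (Ext M (selfRight R) 1) := by
  simp only [modGrade, le_iInf_iff, ← not_nontrivial_iff_subsingleton]
  constructor
  · intro h
    refine ⟨fun h0 => ?_, fun h1 => ?_⟩
    · exact absurd (h 0 h0) (by decide)
    · exact absurd (h 1 h1) (by decide)
  · rintro ⟨h0, h1⟩ i hi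
    have : 2 ≤ i := by
      rcases i with _ | _ | i
      · exact absurd hi h0
      · exact absurd hi h1
      · omega
    exact_mod_cast this

/-- The grade of a cyclic module `R / I` is at least two if and only if each right linear map
`I → R` is the left multiplication by a unique element of `R`. -/
theorem two_le_modGrade_quotient_iff (I : Submodule Rᵐᵒᵖ R) :
    2 ≤ modGrade (ModuleCat.of Rᵐᵒᵖ (R ⧸ I)) ↔
      (∀ b : R, (∀ x ∈ I, b * x = 0) → b = 0) ∧
        ∀ f : I →ₗ[Rᵐᵒᵖ] R, ∃ b : R, ∀ x : I, f x = b * x.1 := by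
  have hS : (ShortComplex.mk (ModuleCat.ofHom I.subtype) (ModuleCat.ofHom I.mkQ)
      (by ext; simp)).ShortExact :=
    { exact := by
        rw [ShortComplex.moduleCat_exact_iff]
        intro x hx
        exact ⟨⟨x, (Submodule.Quotient.mk_eq_zero I).1 hx⟩, rfl⟩
      mono_f := (ModuleCat.mono_iff_injective _).2 Subtype.val_injective
      epi_g := (ModuleCat.epi_iff_surjective _).2 I.mkQ_surjective }
  have linear_eq : ∀ (g : R →ₗ[Rᵐᵒᵖ] R) (x : R), g x = g 1 * x := fun g x => by
    simpa using g.map_smul (MulOpposite.op x) 1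
  let mulLeft : R → (R →ₗ[Rᵐᵒᵖ] R) := fun b =>
    { toFun := fun x => b * x
      map_add' := mul_add b
      map_smul' := fun r x => (mul_assoc b x r.unop).symm }
  rw [two_le_modGrade_iff]
  refine and_congr ?_ ?_
  · rw [Ext.homEquiv₀.subsingleton_congr]
    constructor
    · intro h b hb
      have : b * 1 = 0 := congrArg (fun f => f.hom (I.mkQ 1)) (Subsingleton.elim
        (ModuleCat.ofHom (I.liftQ (mulLeft b) hb) : ModuleCat.of Rᵐᵒᵖ (R ⧸ I) ⟶ selfRight R) 0)
      simpa using this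
    · intro h
      refine ⟨fun f g => ?_⟩
      rw [← sub_eq_zero]
      generalize f - g = f
      have hf : f.hom (I.mkQ 1) = 0 := by
        refine h _ fun x hx => ?_
        have := linear_eq (f.hom.comp I.mkQ) x
        change f.hom (I.mkQ x) = f.hom (I.mkQ 1) * x at this
        rw [← this]
        exact (congrArg f.hom ((Submodule.Quotient.mk_eq_zero I).2 hx)).trans (map_zero _)
      ext
      exact hf
  · constructor
    · intro h f
      -- The obstruction to extending `f` from `I` to `R` lies in `Ext¹(R/I, R) = 0`.
      obtain ⟨g, hg⟩ := Ext.contravariant_sequence_exact₁ hS (selfRight R)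
        (Ext.mk₀ (ModuleCat.ofHom f)) (n₁ := 1) rfl (Subsingleton.elim _ _)
      obtain ⟨g, rfl⟩ := Ext.homEquiv₀.symm.surjective g
      change (Ext.mk₀ _).comp (Ext.mk₀ g) _ = _ at hg
      rw [Ext.mk₀_comp_mk₀] at hg
      have hg := Ext.homEquiv₀.symm.injective hg
      refine ⟨g.hom (1 : R), fun x => ?_⟩
      rw [← linear_eq g.hom x.1]
      exact congrArg (fun k => k.hom x) hg.symm
    · intro h
      have : Projective (ModuleCat.of Rᵐᵒᵖ R) := by
        have : Module.Projective Rᵐᵒᵖ R := .of_equiv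
          { MulOpposite.opAddEquiv.symm with map_smul' := fun _ _ => rfl : Rᵐᵒᵖ ≃ₗ[Rᵐᵒᵖ] R }
        exact (IsProjective.iff_projective R).1 this
      -- The index `0` stands for degree `0 + 1`: this is `Ext¹(R, R) = 0`.
      have := Ext.subsingleton_of_projective (ModuleCat.of Rᵐᵒᵖ R) (selfRight R) 0
      have ext_eq_zero : ∀ x : Ext (ModuleCat.of Rᵐᵒᵖ (R ⧸ I)) (selfRight R) 1, x = 0 := by
        intro x
        -- Every class comes from some `f : I → R`; as `f` extends to a left multiplication on `R`,
        -- the class vanishes.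
        obtain ⟨y, rfl⟩ := Ext.contravariant_sequence_exact₃ hS (selfRight R) x
          (Subsingleton.elim _ _) (n₀ := 0) rfl
        obtain ⟨f, rfl⟩ := Ext.homEquiv₀.symm.surjective y
        obtain ⟨b, hb⟩ := h f.hom
        have : f = ModuleCat.ofHom I.subtype ≫ ModuleCat.ofHom (mulLeft b) := by
          ext x
          exact hb x
        change hS.extClass.comp (Ext.mk₀ f) _ = 0
        rw [this, ← Ext.mk₀_comp_mk₀, hS.extClass_comp_assoc]
      exact ⟨fun x y => (ext_eq_zero x).trans (ext_eq_zero y).symm⟩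

end Grade

/-! ### Comparison of `Hom_B(BeB, B)` with `End_A(Be)` -/

section TwoSided

variable {B : Type u} [Ring B] {e : B}

theorem mul_mem_twoSided (b : B) {x : B} (hx : x ∈ leftIdeal e) (c : B) :
    b * x * c ∈ twoSided e := by
  obtain ⟨x, rfl⟩ := Submodule.mem_span_singleton.1 hx
  exact Submodule.subset_span ⟨b * x, c, by simp [mul_assoc]⟩

theorem leftIdeal_le_twoSided {x : B} (hx : x ∈ leftIdeal e) : x ∈ twoSided e := by
  simpa using mul_mem_twoSided 1 hx 1

theorem mul_eq_zero_on_twoSided_iff (b : B) :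
    (∀ x ∈ twoSided e, b * x = 0) ↔ ∀ x ∈ leftIdeal e, b * x = 0 := by
  refine ⟨fun h x hx => h x (leftIdeal_le_twoSided hx), fun h x hx => ?_⟩
  induction hx using Submodule.span_induction with
  | mem x hx =>
    obtain ⟨y, c, rfl⟩ := hx
    have : b * (y * e) = 0 := h _ (Submodule.mem_span_singleton.2 ⟨y, rfl⟩)
    rw [← mul_assoc, this, zero_mul]
  | zero => exact mul_zero b
  | add x y _ _ hx hy => rw [mul_add, hx, hy, add_zero]
  | smul a x _ hx => rw [MulOpposite.smul_eq_mul_unop, ← mul_assoc, hx, zero_mul]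

variable (he : IsIdempotentElem e)

/-- An `eBe`-linear endomorphism of `Be` extends to a right `B`-linear map `BeB → B`, if `BeB` has
no nonzero left annihilator. -/
theorem exists_extend_twoSided (h : ∀ b : B, (∀ x ∈ twoSided e, b * x = 0) → b = 0)
    (θ : Module.End (he.Corner)ᵐᵒᵖ (leftIdeal e)) :
    ∃ f : twoSided e →ₗ[Bᵐᵒᵖ] B, ∀ (x : leftIdeal e),
      f ⟨x.1, leftIdeal_le_twoSided x.2⟩ = (θ x).1 := by
  -- The graph of the intended extension `∑ xᵢcᵢ ↦ ∑ θ(xᵢ)cᵢ`.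
  let T : Submodule Bᵐᵒᵖ (B × B) :=
    Submodule.span Bᵐᵒᵖ {p | ∃ (x : leftIdeal e) (c : B), p = (x.1 * c, (θ x).1 * c)}
  -- Since `ecz` lies in `A`, linearity gives `θ(xcz) = θ(x)(ecz) = θ(x)cz`.
  have key : ∀ p ∈ T, ∀ z : leftIdeal e, p.2 * z.1 = (θ (p.1 • z)).1 := by
    intro p hp
    induction hp using Submodule.span_induction with
    | mem p hp =>
      obtain ⟨x, c, rfl⟩ := hp
      intro z
      let a : he.Corner := cornerMul he (MulOpposite.op c • rightE e) z
      have h₁ : (x.1 * c) • z = MulOpposite.op a • x := Subtype.ext <| by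
        change x.1 * c * z.1 = x.1 * (e * c * z.1)
        rw [← mul_assoc, ← mul_assoc, leftIdeal_mul_e he x.2]
      rw [h₁, map_smul, coe_smul_leftIdeal]
      change (θ x).1 * c * z.1 = (θ x).1 * (e * c * z.1)
      rw [← mul_assoc, ← mul_assoc, leftIdeal_mul_e he (θ x).2]
    | zero => simp
    | add p q _ _ hp hq => intro z; simp [add_mul, add_smul, hp, hq]
    | smul b p _ hp =>
      intro z
      have := hp (b.unop • z)
      simpa [mul_assoc, smul_smul] using this
  let π : T →ₗ[Bᵐᵒᵖ] B := (LinearMap.fst Bᵐᵒᵖ B B).comp T.subtype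
  -- `T` is single-valued: if `(0, y)` lies in `T`, then `y` kills `Be` by `key`, hence kills `BeB`,
  -- hence is zero by `h`.
  have π_injective : Function.Injective π := by
    refine (injective_iff_map_eq_zero π).2 fun p hp => ?_
    have hp : p.1.1 = 0 := hp
    refine Subtype.ext (Prod.ext hp (h _ ((mul_eq_zero_on_twoSided_iff _).2 fun z hz => ?_)))
    rw [key p.1 p.2 ⟨z, hz⟩, hp, zero_smul, map_zero]
    rfl
  have le_range : twoSided e ≤ LinearMap.range π := by
    refine Submodule.span_le.2 ?_
    rintro _ ⟨b, c, rfl⟩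
    exact ⟨⟨_, Submodule.subset_span ⟨b • leftE e, c, rfl⟩⟩, rfl⟩
  refine ⟨(LinearMap.snd Bᵐᵒᵖ B B).comp (T.subtype.comp
    ((LinearEquiv.ofInjective π π_injective).symm.toLinearMap.comp
      (Submodule.inclusion le_range))), fun x => ?_⟩
  let p : T := ⟨(x.1, (θ x).1), Submodule.subset_span ⟨x, 1, by simp⟩⟩
  have hp : (LinearEquiv.ofInjective π π_injective).symm
      (Submodule.inclusion le_range ⟨x.1, leftIdeal_le_twoSided x.2⟩) = p := by
    rw [LinearEquiv.symm_apply_eq]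
    rfl
  exact congrArg (fun q : T => q.1.2) hp

theorem map_twoSided_eq (f : twoSided e →ₗ[Bᵐᵒᵖ] B) (b : B)
    (hb : ∀ x : leftIdeal e, f ⟨x.1, leftIdeal_le_twoSided x.2⟩ = b * x.1) (x : twoSided e) :
    f x = b * x.1 := by
  obtain ⟨x, hx⟩ := x
  induction hx using Submodule.span_induction with
  | mem x hx =>
    obtain ⟨y, c, rfl⟩ := hx
    have := f.map_smul (MulOpposite.op c)
      ⟨y * e, leftIdeal_le_twoSided (Submodule.mem_span_singleton.2 ⟨y, rfl⟩)⟩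
    refine this.trans ?_
    rw [hb ⟨y * e, Submodule.mem_span_singleton.2 ⟨y, rfl⟩⟩]
    exact mul_assoc _ _ _
  | zero => exact f.map_zero.trans (mul_zero b).symm
  | add x y hx hy h₁ h₂ =>
    exact (f.map_add ⟨x, hx⟩ ⟨y, hy⟩).trans ((congrArg₂ _ h₁ h₂).trans (mul_add _ _ _).symm)
  | smul a x hx h =>
    exact (f.map_smul a ⟨x, hx⟩).trans ((congrArg _ h).trans (mul_assoc _ _ _))

/-- The restriction to `Be` of a right `B`-linear map `BeB → B`. -/
def restrictTwoSided (f : twoSided e →ₗ[Bᵐᵒᵖ] B) : Module.End (he.Corner)ᵐᵒᵖ (leftIdeal e) where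
  toFun x := ⟨f ⟨x.1, leftIdeal_le_twoSided x.2⟩, Submodule.mem_span_singleton.2
    ⟨f ⟨x.1, leftIdeal_le_twoSided x.2⟩, by
      rw [smul_eq_mul]
      -- The image stays in `Be` because `f(x) = f(xe) = f(x)e`.
      refine (f.map_smul (MulOpposite.op e) _).symm.trans (congrArg f (Subtype.ext ?_))
      exact leftIdeal_mul_e he x.2⟩⟩
  map_add' x y := Subtype.ext
    (f.map_add ⟨x.1, leftIdeal_le_twoSided x.2⟩ ⟨y.1, leftIdeal_le_twoSided y.2⟩)
  map_smul' a x := Subtype.ext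
    (f.map_smul (MulOpposite.op a.unop.1) ⟨x.1, leftIdeal_le_twoSided x.2⟩)

/-- The `Ext⁰` condition is injectivity of `φ`, since `BeB` and `Be` have the same left annihilator.
Given this, the `Ext¹` condition becomes surjectivity by extending endomorphisms of `Be` to `BeB`
and restricting back. -/
theorem two_le_modGrade_iff_leftMulHom_bijective (k : Type w) [CommRing k] [Algebra k B] :
    2 ≤ modGrade (quotBeB e) ↔ Function.Bijective (leftMulHom k he) := by
  have inj_iff : Function.Injective (leftMulHom k he) ↔
      ∀ b : B, (∀ x ∈ twoSided e, b * x = 0) → b = 0 := by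
    rw [injective_iff_map_eq_zero]
    refine forall_congr' fun b => imp_congr_left ?_
    rw [mul_eq_zero_on_twoSided_iff]
    exact ⟨fun h x hx => congrArg Subtype.val (LinearMap.congr_fun h ⟨x, hx⟩),
      fun h => LinearMap.ext fun x => Subtype.ext (h x.1 x.2)⟩
  rw [two_le_modGrade_quotient_iff, Function.Bijective, inj_iff]
  refine and_congr_right fun h => ⟨fun hf θ => ?_, fun hs f => ?_⟩
  · obtain ⟨f, hθ⟩ := exists_extend_twoSided he h θ
    obtain ⟨b, hb⟩ := hf f
    exact ⟨b, LinearMap.ext fun x => Subtype.ext ((hb _).symm.trans (hθ x))⟩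
  · obtain ⟨b, hb⟩ := hs (restrictTwoSided he f)
    exact ⟨b, map_twoSided_eq f b fun x =>
      (congrArg Subtype.val (LinearMap.congr_fun hb x).symm)⟩

end TwoSided

/-! ### Small modules under restriction and induction -/

section Quotient

variable {B : Type u} [Ring B] {e : B} (he : IsIdempotentElem e)

theorem inductCounit_naturality {N N' : Type u} [AddCommGroup N] [Module Bᵐᵒᵖ N] [AddCommGroup N']
    [Module Bᵐᵒᵖ N'] (f : N →ₗ[Bᵐᵒᵖ] N')
    (t : BiTensor he.Corner B (BiTensor B he.Corner N (leftIdeal e)) (rightIdeal e)) :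
    inductCounit he N' (biTensorMap he.Corner B (rightIdeal e)
      (biTensorMap B he.Corner (leftIdeal e) f) t) = f (inductCounit he N t) := by
  induction t using biTensor_induction with
  | zero => simp only [map_zero]
  | tmul t x =>
    rw [biTensorMap_tmul, inductCounit_tmul, restrictEval_map, inductCounit_tmul, map_smul]
  | add x y hx hy => simp only [map_add, hx, hy]

attribute [local instance] fg_finite

theorem subsingleton_biTensor_leftIdeal {N : Type u} [AddCommGroup N] [Module Bᵐᵒᵖ N]
    (hN : ∀ n : N, MulOpposite.op e • n = 0) :
    Subsingleton (BiTensor B he.Corner N (leftIdeal e)) :=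
  ⟨fun t t' => restrictEval_injective he <| by
    rw [← op_e_smul_restrictEval, hN, ← op_e_smul_restrictEval, hN]⟩

theorem op_e_smul_quotBeB (x : quotBeB e) : MulOpposite.op e • x = 0 := by
  obtain ⟨b, rfl⟩ := (twoSided e).mkQ_surjective x
  refine (Submodule.Quotient.mk_eq_zero _).2 (Submodule.subset_span ⟨b, 1, ?_⟩)
  simp

theorem finite_quotBeB : Module.Finite Bᵐᵒᵖ (quotBeB e) := by
  have : Module.Finite Bᵐᵒᵖ B := Module.Finite.of_surjective
    ({ MulOpposite.opAddEquiv.symm with map_smul' := fun _ _ => rfl } : Bᵐᵒᵖ →ₗ[Bᵐᵒᵖ] B)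
    MulOpposite.unop_surjective
  exact Module.Finite.quotient _ _

variable [IsNoetherianRing Bᵐᵒᵖ] {dimB : ModuleCat.{u} Bᵐᵒᵖ → EReal}

/-- If `Ne = 0` then `BeB` annihilates `N`, so each cyclic submodule of `N` is a quotient of
`B/BeB`. -/
theorem IsExactDimensionFunction.le_of_smul_e_eq_zero (hB : IsExactDimensionFunction dimB)
    {t : EReal} (ht : dimB (quotBeB e) ≤ t) {N : Type u} [AddCommGroup N] [Module Bᵐᵒᵖ N]
    [Module.Finite Bᵐᵒᵖ N] (hN : ∀ n : N, MulOpposite.op e • n = 0) :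
    dimB (ModuleCat.of _ N) ≤ t := by
  refine hB.le_of_cyclic fun x => ?_
  let g : B →ₗ[Bᵐᵒᵖ] N :=
    { toFun := fun b => MulOpposite.op b • x
      map_add' := fun b c => by rw [MulOpposite.op_add, add_smul]
      map_smul' := fun b c => by
        rw [MulOpposite.smul_eq_mul_unop, MulOpposite.op_mul, MulOpposite.op_unop, mul_smul]
        rfl }
  have hg : twoSided e ≤ LinearMap.ker g := by
    refine Submodule.span_le.2 ?_
    rintro _ ⟨b, c, rfl⟩
    change MulOpposite.op (b * e * c) • x = 0
    rw [MulOpposite.op_mul, MulOpposite.op_mul, mul_smul, mul_smul, hN, smul_zero]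
  have hx : Submodule.span Bᵐᵒᵖ {x} = LinearMap.range ((twoSided e).liftQ g hg) := by
    ext y
    rw [Submodule.mem_span_singleton, LinearMap.mem_range]
    constructor
    · rintro ⟨b, rfl⟩
      exact ⟨(twoSided e).mkQ b.unop, rfl⟩
    · rintro ⟨z, rfl⟩
      obtain ⟨b, rfl⟩ := (twoSided e).mkQ_surjective z
      exact ⟨MulOpposite.op b, rfl⟩
  rw [hB.eq_of_linearEquiv (LinearEquiv.ofEq _ _ hx)]
  have := finite_quotBeB (e := e)
  exact (hB.le_of_surjective _ (LinearMap.surjective_rangeRestrict _)).trans ht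

variable [Module.Finite (he.Corner)ᵐᵒᵖ (leftIdeal e)]
  {dimA : ModuleCat.{u} (he.Corner)ᵐᵒᵖ → EReal} {t : ℝ}

/-- If `∂(B/BeB) ≤ t`, then a finitely generated module `N` with `∂(N e) ≤ t` has `∂(N) ≤ t`. -/
theorem dim_le_of_restrict_le (hB : IsExactDimensionFunction dimB)
    (hγ : SatisfiesGamma he.Corner B (rightIdeal e) dimA dimB t 0)
    (ht : dimB (quotBeB e) ≤ t) (N : Type u) [AddCommGroup N] [Module Bᵐᵒᵖ N]
    [Module.Finite Bᵐᵒᵖ N]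
    (hN : dimA (ModuleCat.of _ (BiTensor B he.Corner N (leftIdeal e))) ≤ t) :
    dimB (ModuleCat.of _ N) ≤ t := by
  -- The image of the counit is bounded through `Tor_0`, its cokernel through `B/BeB`.
  refine hB.le_of_submodule (LinearMap.range (inductCounit he N)) ?_ ?_
  · obtain ⟨hfin, hdim⟩ := hγ (ModuleCat.of _ (BiTensor B he.Corner N (leftIdeal e)))
      (biTensor_finite B he.Corner (leftIdeal e)) hN 0 le_rfl
    obtain ⟨f, hf⟩ := exists_epi_tor_zero he.Corner B (rightIdeal e)
      (ModuleCat.of _ (BiTensor B he.Corner N (leftIdeal e)))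
    rw [ModuleCat.epi_iff_surjective] at hf
    exact (hB.le_of_surjective ((inductCounit he N).rangeRestrict.comp f.hom)
      ((LinearMap.surjective_rangeRestrict _).comp hf)).trans hdim
  · refine hB.le_of_smul_e_eq_zero ht fun x => ?_
    obtain ⟨n, rfl⟩ := Submodule.mkQ_surjective _ x
    exact (Submodule.Quotient.mk_eq_zero _).2 (op_e_smul_mem_range_inductCounit he n)

/-- The functor `- ⊗_B Be` on finitely generated modules. -/
abbrev restrictFunctor : FGModuleCat.{u} Bᵐᵒᵖ ⥤ FGModuleCat.{u} (he.Corner)ᵐᵒᵖ :=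
  fgTensorFunctor B he.Corner (leftIdeal e)

/-- The functor `- ⊗_A eB` on finitely generated modules. -/
abbrev inductFunctor : FGModuleCat.{u} (he.Corner)ᵐᵒᵖ ⥤ FGModuleCat.{u} Bᵐᵒᵖ :=
  fgTensorFunctor he.Corner B (rightIdeal e)

variable [IsNoetherianRing (he.Corner)ᵐᵒᵖ]

theorem isoModLE_restrictFunctor_map_iff (hA : IsExactDimensionFunction dimA)
    {X Y : FGModuleCat.{u} Bᵐᵒᵖ} (f : X ⟶ Y) :
    isoModLE dimA t ((restrictFunctor he).map f) ↔
      dimA (ModuleCat.of _ (BiTensor B he.Corner (LinearMap.ker f.hom.hom) (leftIdeal e))) ≤ t ∧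
      dimA (ModuleCat.of _
        (BiTensor B he.Corner (Y.obj ⧸ LinearMap.range f.hom.hom) (leftIdeal e))) ≤ t := by
  rw [isoModLE_iff hA, hA.eq_of_linearEquiv (kerRestrictEquiv he f.hom.hom),
    ← hA.eq_of_linearEquiv (cokerRestrictEquiv he f.hom.hom)]
  rfl

theorem isoModLE_restrictFunctor_map (hA : IsExactDimensionFunction dimA)
    (hB : IsExactDimensionFunction dimB)
    (hres : ∀ N : ModuleCat.{u} Bᵐᵒᵖ, Module.Finite Bᵐᵒᵖ N →
      dimA ((tensorFunctor B he.Corner (leftIdeal e)).obj N) ≤ dimB N)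
    {X Y : FGModuleCat.{u} Bᵐᵒᵖ} (f : X ⟶ Y) (hf : isoModLE dimB t f) :
    isoModLE dimA t ((restrictFunctor he).map f) := by
  rw [isoModLE_iff hB] at hf
  rw [isoModLE_restrictFunctor_map_iff he hA]
  exact ⟨(hres (ModuleCat.of _ (LinearMap.ker f.hom.hom)) (inferInstanceAs
      (Module.Finite Bᵐᵒᵖ (LinearMap.ker f.hom.hom)))).trans hf.1,
    (hres (ModuleCat.of _ (Y.obj ⧸ LinearMap.range f.hom.hom)) (inferInstanceAs
      (Module.Finite Bᵐᵒᵖ (Y.obj ⧸ LinearMap.range f.hom.hom)))).trans hf.2⟩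

theorem isoModLE_of_isoModLE_restrictFunctor_map (hA : IsExactDimensionFunction dimA)
    (hB : IsExactDimensionFunction dimB)
    (hγ : SatisfiesGamma he.Corner B (rightIdeal e) dimA dimB t 0)
    (ht : dimB (quotBeB e) ≤ t)
    {X Y : FGModuleCat.{u} Bᵐᵒᵖ} (f : X ⟶ Y) (hf : isoModLE dimA t ((restrictFunctor he).map f)) :
    isoModLE dimB t f := by
  rw [isoModLE_restrictFunctor_map_iff he hA] at hf
  rw [isoModLE_iff hB]
  exact ⟨dim_le_of_restrict_le he hB hγ ht _ hf.1, dim_le_of_restrict_le he hB hγ ht _ hf.2⟩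

/-- The natural isomorphism `M ≅ (M ⊗_A eB) ⊗_B Be`. -/
def inductUnitIso : 𝟭 (FGModuleCat.{u} (he.Corner)ᵐᵒᵖ) ≅ inductFunctor he ⋙ restrictFunctor he :=
  NatIso.ofComponents
    (fun M => ObjectProperty.isoMk _
      (LinearEquiv.ofBijective (inductUnit he M.obj) (inductUnit_bijective he M.obj)).toModuleIso)
    (fun _ => rfl)

/-- The natural transformation `(N ⊗_B Be) ⊗_A eB → N`. -/
def inductCounitTrans : restrictFunctor he ⋙ inductFunctor he ⟶ 𝟭 (FGModuleCat.{u} Bᵐᵒᵖ) where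
  app N := ObjectProperty.homMk (ModuleCat.ofHom (inductCounit he N.obj))
  naturality _ _ f := by
    ext x
    exact inductCounit_naturality he f.hom.hom x

/-- By the triangle identity this map is a one-sided inverse of the unit, which is invertible. -/
instance isIso_restrictFunctor_map_inductCounitTrans_app (N : FGModuleCat.{u} Bᵐᵒᵖ) :
    IsIso ((restrictFunctor he).map ((inductCounitTrans he).app N)) := by
  have h : (inductUnitIso he).hom.app ((restrictFunctor he).obj N) ≫
      (restrictFunctor he).map ((inductCounitTrans he).app N) = 𝟙 _ := by
    ext t
    exact biTensorMap_inductCounit_comp_inductUnit he t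
  exact IsIso.of_isIso_fac_left h

end Quotient

/-! ### Equivalences between localizations -/

section Localization

variable {C D : Type*} [Category C] [Category D] {W : MorphismProperty C}
  {V : MorphismProperty D} 

/-- A functor with a section up to isomorphism on one side, and up to a natural transformation that
it inverts on the other, induces an equivalence of localizations. -/
theorem isEquivalence_of_lifting (E : C ⥤ D) (G : D ⥤ C) (u : 𝟭 D ≅ G ⋙ E) (c : E ⋙ G ⟶ 𝟭 C)
    (hc : ∀ X, IsIso (E.map (c.app X))) (hV : ∀ ⦃X Y : D⦄ (f : X ⟶ Y), IsIso f → V f)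
    [V.RespectsIso] (hW : W = V.inverseImage E)
    (F : W.Localization ⥤ V.Localization) (i : W.Q ⋙ F ≅ E ⋙ V.Q) : F.IsEquivalence := by
  have hWinv : ∀ {X Y : C} (f : X ⟶ Y), V (E.map f) → IsIso (W.Q.map f) := fun f hf =>
    Localization.inverts W.Q W f (by rw [hW]; exact hf)
  -- `u` identifies `E(G(f))` with `f`, so `G` sends `V` into the inverse image of `V` under `E`,
  -- which is `W`.
  have hG : V.IsInvertedBy (G ⋙ W.Q) := fun X Y f hf => hWinv _ <| by
    change V ((G ⋙ E).map f)
    exact (MorphismProperty.arrow_mk_iso_iff V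
      (((Functor.mapArrowFunctor _ _).mapIso u).app (Arrow.mk f))).1 hf
  let G' : V.Localization ⥤ W.Localization := Localization.lift (G ⋙ W.Q) hG V.Q
  let j : V.Q ⋙ G' ≅ G ⋙ W.Q := Localization.fac _ hG V.Q
  have hcW : IsIso (Functor.whiskerRight c W.Q) := by
    rw [NatTrans.isIso_iff_isIso_app]
    exact fun X => hWinv _ (hV _ (hc X))
  let η : W.Q ⋙ F ⋙ G' ≅ W.Q :=
    (Functor.associator _ _ _).symm ≪≫ Functor.isoWhiskerRight i G' ≪≫ Functor.associator _ _ _ ≪≫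
      Functor.isoWhiskerLeft E j ≪≫ (Functor.associator _ _ _).symm ≪≫
      asIso (Functor.whiskerRight c W.Q) ≪≫ Functor.leftUnitor _
  let ε : V.Q ⋙ G' ⋙ F ≅ V.Q :=
    (Functor.associator _ _ _).symm ≪≫ Functor.isoWhiskerRight j F ≪≫ Functor.associator _ _ _ ≪≫
      Functor.isoWhiskerLeft G i ≪≫ (Functor.associator _ _ _).symm ≪≫
      Functor.isoWhiskerRight u.symm V.Q ≪≫ Functor.leftUnitor _
  have : Localization.Lifting W.Q W (W.Q ⋙ F ⋙ G') (F ⋙ G') := ⟨Iso.refl _⟩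
  have : Localization.Lifting V.Q V (V.Q ⋙ G' ⋙ F) (G' ⋙ F) := ⟨Iso.refl _⟩
  exact (CategoryTheory.Equivalence.mk F G'
    (Localization.liftNatIso W.Q W W.Q (W.Q ⋙ F ⋙ G') (𝟭 _) (F ⋙ G') η.symm)
    (Localization.liftNatIso V.Q V (V.Q ⋙ G' ⋙ F) V.Q (G' ⋙ F) (𝟭 _) ε)).isEquivalence_functor

end Localization

end QuotMorita

end

/-! ### The main theorem -/

theorem theorem2p4
    {k : Type w} [CommRing k] [IsDomain k] [IsNoetherianRing k]
    {B : Type u} [Ring B] [Algebra k B] [Module.Projective k B]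
    [IsNoetherianRing B] [IsNoetherianRing Bᵐᵒᵖ]
    {e : B} (he : IsIdempotentElem e)
    [IsNoetherianRing he.Corner] [IsNoetherianRing (he.Corner)ᵐᵒᵖ]
    [Module.Finite he.Corner (rightIdeal e)] [Module.Finite (he.Corner)ᵐᵒᵖ (leftIdeal e)]
    (dimA : ModuleCat.{u} (he.Corner)ᵐᵒᵖ → EReal) (dimB : ModuleCat.{u} Bᵐᵒᵖ → EReal)
    (hA : IsExactDimensionFunction dimA) (hB : IsExactDimensionFunction dimB)
    (d : ℕ) (hd : 2 ≤ d) (hCM : IsDimCM dimB d 2)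
    (hres : ∀ N : ModuleCat.{u} Bᵐᵒᵖ, Module.Finite Bᵐᵒᵖ N →
      dimA ((tensorFunctor B he.Corner (leftIdeal e)).obj N) ≤ dimB N)
    (hγ : SatisfiesGamma he.Corner B (rightIdeal e) dimA dimB ((d : ℝ) - 2) 1) :
    ∃ F : qmod dimB ((d : ℝ) - 2) ⥤ qmod dimA ((d : ℝ) - 2),
      Nonempty (qmodProj dimB ((d : ℝ) - 2) ⋙ F ≅
        fgTensorFunctor B he.Corner (leftIdeal e) ⋙ qmodProj dimA ((d : ℝ) - 2)) ∧
      List.TFAE [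
        F.IsEquivalence,
        Function.Bijective (leftMulHom k he),
        dimB (quotBeB e) ≤ (((d : ℝ) - 2 : ℝ) : EReal),
        2 ≤ modGrade (quotBeB e)] := by
  set t : ℝ := (d : ℝ) - 2
  have hCM' : ∀ M : ModuleCat.{u} Bᵐᵒᵖ, Module.Finite Bᵐᵒᵖ M →
      (dimB M ≤ (t : EReal) ↔ 2 ≤ modGrade M) := by
    simpa only [Nat.cast_ofNat] using hCM.2
  -- The zero module has no nonzero `Ext`, so the Cohen-Macaulay condition bounds its dimension.
  have hB0 : dimB (ModuleCat.of _ PUnit) ≤ t := by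
    rw [hCM' _ (inferInstanceAs (Module.Finite Bᵐᵒᵖ PUnit.{u + 1})), two_le_modGrade_iff]
    have := (IsProjective.iff_projective (R := Bᵐᵒᵖ) PUnit.{u + 1}).1 inferInstance
    refine ⟨?_, Abelian.Ext.subsingleton_of_projective _ _ 0⟩
    rw [Abelian.Ext.homEquiv₀.subsingleton_congr]
    exact ⟨(ModuleCat.isZero_of_subsingleton _).eq_of_src⟩
  -- Condition 2 for `N = 0` transfers the bound to `A`.
  have hA0 : dimA (ModuleCat.of _ PUnit) ≤ t := by
    have := subsingleton_biTensor_leftIdeal he (N := PUnit.{u + 1}) fun _ => rfl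
    rw [← hA.eq_of_linearEquiv
      (0 : BiTensor B he.Corner PUnit (leftIdeal e) ≃ₗ[(he.Corner)ᵐᵒᵖ] PUnit.{u + 1})]
    exact (hres (ModuleCat.of _ PUnit) (inferInstanceAs (Module.Finite Bᵐᵒᵖ PUnit.{u + 1}))).trans hB0
  have hγ0 : SatisfiesGamma he.Corner B (rightIdeal e) dimA dimB t 0 :=
    fun M hM hMt j hj => hγ M hM hMt j (hj.trans zero_le_one)
  have hE : (isoModLE dimB t).IsInvertedBy (restrictFunctor he ⋙ qmodProj dimA t) :=
    fun X Y f hf => Localization.inverts (isoModLE dimA t).Q _ _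
      (isoModLE_restrictFunctor_map he hA hB hres f hf)
  let i := Localization.fac _ hE (qmodProj dimB t)
  refine ⟨_, ⟨i⟩, ?_⟩
  tfae_have 4 ↔ 2 := two_le_modGrade_iff_leftMulHom_bijective he k
  tfae_have 3 ↔ 4 := hCM' _ finite_quotBeB
  tfae_have 3 → 1 := fun ht => by
    have := isSerreClass_modLE hA hA0
    have : (isoModLE dimA t).RespectsIso :=
      inferInstanceAs ((modLE dimA t).isoModSerre.RespectsIso)
    refine isEquivalence_of_lifting (restrictFunctor he) (inductFunctor he) (inductUnitIso he)
      (inductCounitTrans he) inferInstance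
      (fun X Y f hf => (modLE dimA t).isomorphisms_le_isoModSerre f hf) ?_ _ i
    -- Condition 2 shows that restriction preserves the inverted morphisms; that it also reflects
    -- them is where the bound on `B/BeB` enters.
    ext X Y f
    exact ⟨isoModLE_restrictFunctor_map he hA hB hres f,
      isoModLE_of_isoModLE_restrictFunctor_map he hA hB hγ0 ht f⟩
  tfae_have 1 → 3 := fun h => by
    let X : FGModuleCat.{u} Bᵐᵒᵖ := ⟨quotBeB e, finite_quotBeB⟩
    have := subsingleton_biTensor_leftIdeal he (op_e_smul_quotBeB (e := e))
    have hX : IsZero ((qmodProj dimA t).obj ((restrictFunctor he).obj X)) := by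
      rw [isZero_qmodProj_obj_iff hA hA0]
      refine le_trans (le_of_eq ?_) hA0
      exact hA.eq_of_linearEquiv
        (0 : BiTensor B he.Corner (quotBeB e) (leftIdeal e) ≃ₗ[(he.Corner)ᵐᵒᵖ] PUnit.{u + 1})
    -- `F` is fully faithful and sends the image of `B/BeB` to zero, so that image is itself zero.
    exact (isZero_qmodProj_obj_iff hB hB0 X).1
      (IsZero.of_full_of_faithful_of_isZero _ _ (hX.of_iso (i.app X)))
  tfae_finish
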